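/- For positive integers $w$ and $h$, a *Young diagram of size $w\times h$* is a sequence of positive integers $x_1\le x_2\le\dots\le x_h=w$, and its *number of steps* is the number of distinct integers among $x_1,\dots,x_h$. For every integer $d\neq 0$ there exists $w_0$ such that for every integer $w>w_0$ the following holds: the number of Young diagrams of size $w\times(w+d)$ with an odd number of steps is strictly greater than the number of those with an even number of steps if and only if $2w+d$ is congruent to $1$, $2$, $3$, or $4$ modulo $8$. -/

import Mathlib

/-- A Young diagram of size `w × h`: a sequence of positive integers `x₁ ≤ ⋯ ≤ x_h = w`
(the stripe lengths). The entry `x_h` is `x i` for the `i : Fin h` with `i + 1 = h`. -/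
structure IsYoungDiagramOfSize (w h : ℕ) (x : Fin h → ℕ) : Prop where
  pos : ∀ i, 0 < x i
  mono : Monotone x
  last : ∃ i : Fin h, (i : ℕ) + 1 = h ∧ x i = w

/-- The number of steps: the number of distinct integers among `x₁, …, x_h`. -/
def numSteps {h : ℕ} (x : Fin h → ℕ) : ℕ :=
  (Finset.univ.image x).card

/-- The set of Young diagrams of size `w × h` with an odd number of steps. -/
def oddStepDiagrams (w h : ℕ) : Set (Fin h → ℕ) :=
  {x | IsYoungDiagramOfSize w h x ∧ Odd (numSteps x)}

/-- The set of Young diagrams of size `w × h` with an even number of steps. -/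
def evenStepDiagrams (w h : ℕ) : Set (Fin h → ℕ) :=
  {x | IsYoungDiagramOfSize w h x ∧ Even (numSteps x)}

/-- There are finitely many Young diagrams of a given size, so that `Set.ncard` counts them. -/
theorem finite_isYoungDiagramOfSize (w h : ℕ) :
    {x : Fin h → ℕ | IsYoungDiagramOfSize w h x}.Finite := by
  refine (Set.finite_Iic (fun _ : Fin h => w)).subset ?_
  rintro x ⟨-, hm, i, hi, hw⟩ j
  show x j ≤ w
  rw [← hw]
  exact hm (by rw [Fin.le_def]; omega)

/-! ### Signed count: recursion, symmetry and coefficient formula. -/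

section

open Polynomial

/-! Deleting the last stripe gives the odd-minus-even count a Pascal-type recursion, so it is
symmetric in `w`, `h` and equals the coefficient of `X^n` in `(1-X)^m (1+X)^n`, where `m = w-1`, `n
= h-1` (`signedCount_eq_coeff`). For `n = m+d` this product is `(1-X^2)^m (1+X)^d`, so the count is
a sum of `d+1` terms, with near-central binomials of `m` and signs `Re I^(m+j)`.

Write `m = 2p+e`, `e < 2`, and divide by `(-1)^p` times the central binomial. All binomial ratios
tend to 1, so the quotient tends to `Re z` with `z = I^e (1+I)^d`, of argument `(2e+d)π/4`. If `Re z
= 0`, the `1/p` term decides: it is `d²/8 · Im z`, nonzero since `d ≠ 0` (`tendsto_scaledCount`).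
The sign thus depends only on `2m+d` mod 8. -/

/-- The finite set of Young diagrams of size `w × h`. -/
noncomputable def youngDiagrams (w h : ℕ) : Finset (Fin h → ℕ) :=
  (finite_isYoungDiagramOfSize w h).toFinset

/-- The number of diagrams with an odd number of steps minus the number of those with an even
number of steps. -/
noncomputable def signedCount (w h : ℕ) : ℤ :=
  ∑ x ∈ youngDiagrams w h, (-1) ^ (numSteps x + 1)

theorem mem_youngDiagrams {w h : ℕ} {x : Fin h → ℕ} :
    x ∈ youngDiagrams w h ↔ IsYoungDiagramOfSize w h x := by
  simp [youngDiagrams]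

theorem signedCount_eq (w h : ℕ) :
    signedCount w h = (oddStepDiagrams w h).ncard - (evenStepDiagrams w h).ncard := by
  classical
  have ho : oddStepDiagrams w h = ((youngDiagrams w h).filter fun x => Odd (numSteps x)) := by
    ext x; simp [oddStepDiagrams, mem_youngDiagrams]
  have he : evenStepDiagrams w h = ((youngDiagrams w h).filter fun x => ¬ Odd (numSteps x)) := by
    ext x; simp [evenStepDiagrams, mem_youngDiagrams]
  rw [ho, he, Set.ncard_coe_finset, Set.ncard_coe_finset, signedCount,
    ← Finset.sum_filter_add_sum_filter_not _ (fun x => Odd (numSteps x))]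
  rw [Finset.sum_congr rfl (g := fun _ => (1 : ℤ)), Finset.sum_congr (s₁ := Finset.filter
    (fun x => ¬ Odd (numSteps x)) _) rfl (g := fun _ => (-1 : ℤ))]
  · simp [sub_eq_add_neg]
  · intro x hx
    have := (Finset.mem_filter.1 hx).2
    exact (Nat.not_odd_iff_even.1 this).add_one.neg_one_pow
  · intro x hx
    exact (Finset.mem_filter.1 hx).2.add_one.neg_one_pow

theorem isYoungDiagramOfSize_succ_iff {w h : ℕ} {x : Fin (h + 1) → ℕ} :
    IsYoungDiagramOfSize w (h + 1) x ↔ (∀ i, 0 < x i) ∧ Monotone x ∧ x (Fin.last h) = w := by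
  constructor
  · rintro ⟨hp, hm, i, hi, hw⟩
    have : i = Fin.last h := by ext; simp; omega
    exact ⟨hp, hm, this ▸ hw⟩
  · rintro ⟨hp, hm, hw⟩
    exact ⟨hp, hm, Fin.last h, by simp, hw⟩

theorem numSteps_snoc {v w h : ℕ} {x : Fin (h + 1) → ℕ} (hx : IsYoungDiagramOfSize v (h + 1) x)
    (hv : v ≤ w) :
    numSteps (Fin.snoc x w : Fin (h + 2) → ℕ) = numSteps x + if v = w then 0 else 1 := by
  classical
  obtain ⟨-, hm, hl⟩ := isYoungDiagramOfSize_succ_iff.1 hx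
  have him : Finset.univ.image (Fin.snoc x w : Fin (h + 2) → ℕ) =
      insert w (Finset.univ.image x) := by
    ext a
    simp only [Finset.mem_image, Finset.mem_univ, true_and, Finset.mem_insert,
      Fin.exists_fin_succ', Fin.snoc_castSucc, Fin.snoc_last]
    tauto
  unfold numSteps
  rw [him]
  split_ifs with h'
  · rw [Finset.insert_eq_of_mem]
    · simp
    · exact Finset.mem_image.2 ⟨Fin.last h, Finset.mem_univ _, hl.trans h'⟩
  · rw [Finset.card_insert_of_notMem]
    intro hw
    obtain ⟨i, -, hi⟩ := Finset.mem_image.1 hw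
    have := hm (Fin.le_last i)
    omega

theorem isYoungDiagramOfSize_snoc {v w h : ℕ} {x : Fin (h + 1) → ℕ}
    (hx : IsYoungDiagramOfSize v (h + 1) x) (hv : v ≤ w) :
    IsYoungDiagramOfSize w (h + 2) (Fin.snoc x w : Fin (h + 2) → ℕ) := by
  obtain ⟨hp, hm, hl⟩ := isYoungDiagramOfSize_succ_iff.1 hx
  refine isYoungDiagramOfSize_succ_iff.2 ⟨?_, ?_, Fin.snoc_last _ _⟩
  · intro i
    induction i using Fin.lastCases with
    | last => have := hp (Fin.last h); simp only [Fin.snoc_last]; omega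
    | cast i => simpa only [Fin.snoc_castSucc] using hp i
  · refine Fin.monotone_iff_le_succ.2 fun i => ?_
    induction i using Fin.lastCases with
    | last =>
      rw [Fin.succ_last]
      simp only [Fin.snoc_castSucc, Fin.snoc_last]
      omega
    | cast i =>
      rw [← Fin.castSucc_succ]
      simp only [Fin.snoc_castSucc]
      exact hm (Fin.castSucc_lt_succ).le

theorem IsYoungDiagramOfSize.init {w h : ℕ} {x : Fin (h + 2) → ℕ}
    (hx : IsYoungDiagramOfSize w (h + 2) x) :
    IsYoungDiagramOfSize (x (Fin.last h).castSucc) (h + 1) (Fin.init x) := by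
  obtain ⟨hp, hm, hl⟩ := isYoungDiagramOfSize_succ_iff.1 hx
  exact isYoungDiagramOfSize_succ_iff.2 ⟨fun i => hp _, fun i j hij => hm (by simpa using hij), rfl⟩

/-- Delete the last stripe and sort by the new last length `v`; a step is lost, and the sign flips,
exactly when `v ≠ w`. -/
theorem signedCount_add_two (w h : ℕ) :
    signedCount w (h + 2) = ∑ v ∈ Finset.Icc 1 w,
      (if v = w then 1 else -1) * signedCount v (h + 1) := by
  classical
  simp only [signedCount, Finset.mul_sum]
  rw [Finset.sum_sigma']
  symm
  refine Finset.sum_bij'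
    (i := fun (a : Σ _ : ℕ, Fin (h + 1) → ℕ) _ => (Fin.snoc a.2 w : Fin (h + 2) → ℕ))
    (j := fun (x : Fin (h + 2) → ℕ) _ =>
      (⟨x (Fin.last h).castSucc, Fin.init x⟩ : Σ _ : ℕ, Fin (h + 1) → ℕ)) ?_ ?_ ?_ ?_ ?_
  · rintro ⟨v, x⟩ ha
    simp only [Finset.mem_sigma, Finset.mem_Icc, mem_youngDiagrams] at ha ⊢
    exact isYoungDiagramOfSize_snoc ha.2 ha.1.2
  · intro x hx
    rw [mem_youngDiagrams] at hx
    simp only [Finset.mem_sigma, Finset.mem_Icc, mem_youngDiagrams]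
    obtain ⟨hp, hm, hl⟩ := isYoungDiagramOfSize_succ_iff.1 hx
    exact ⟨⟨hp _, hl ▸ hm (Fin.le_last _)⟩, hx.init⟩
  · rintro ⟨v, x⟩ ha
    simp only [Finset.mem_sigma, Finset.mem_Icc, mem_youngDiagrams] at ha
    have := (isYoungDiagramOfSize_succ_iff.1 ha.2).2.2
    simp only [Fin.snoc_castSucc, Fin.init_snoc, this]
  · intro x hx
    rw [mem_youngDiagrams] at hx
    have := (isYoungDiagramOfSize_succ_iff.1 hx).2.2
    simp only [← this, Fin.snoc_init_self]
  · rintro ⟨v, x⟩ ha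
    simp only [Finset.mem_sigma, Finset.mem_Icc, mem_youngDiagrams] at ha
    simp only [numSteps_snoc ha.2 ha.1.2]
    split_ifs <;> simp [pow_succ]

theorem signedCount_one (m : ℕ) : signedCount (m + 1) 1 = 1 := by
  have : youngDiagrams (m + 1) 1 = {fun _ => m + 1} := by
    ext x
    rw [mem_youngDiagrams, isYoungDiagramOfSize_succ_iff, Finset.mem_singleton]
    constructor
    · rintro ⟨-, -, h⟩
      funext i
      rw [Subsingleton.elim i (Fin.last 0), h]
    · rintro rfl
      exact ⟨fun _ => Nat.succ_pos _, monotone_const, rfl⟩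
  simp [signedCount, this, numSteps]

theorem signedCount_succ_succ (m n : ℕ) :
    signedCount (m + 1) (n + 2) =
      signedCount (m + 1) (n + 1) - ∑ v ∈ Finset.range m, signedCount (v + 1) (n + 1) := by
  rw [signedCount_add_two, Finset.sum_Icc_succ_top (by omega), if_pos rfl, one_mul, add_comm,
    sub_eq_add_neg, ← Finset.sum_neg_distrib, Finset.range_eq_Ico,
    Finset.sum_Ico_add' (fun v => -signedCount v (n + 1)) 0 m 1]
  congr 1
  refine Finset.sum_congr (by ext; simp) fun v hv => ?_
  have := Finset.mem_Ico.1 hv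
  rw [if_neg (by omega), neg_one_mul]

/-- Subtracting the summed recursion for two consecutive widths leaves only the top term of the sum.
-/
theorem signedCount_pascal (m n : ℕ) :
    signedCount (m + 2) (n + 2) =
      signedCount (m + 1) (n + 2) + signedCount (m + 2) (n + 1) - 2 * signedCount (m + 1) (n + 1) := by
  rw [signedCount_succ_succ, signedCount_succ_succ, Finset.sum_range_succ]
  ring

theorem signedCount_one_left (n : ℕ) : signedCount 1 (n + 1) = 1 := by
  induction n with
  | zero => exact signedCount_one 0
  | succ n ih => simpa [ih] using signedCount_succ_succ 0 n

theorem eq_of_pascal {f g : ℕ → ℕ → ℤ} (hf₀ : ∀ n, f 0 n = 1) (hf₁ : ∀ m, f m 0 = 1)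
    (hf : ∀ m n, f (m + 1) (n + 1) = f m (n + 1) + f (m + 1) n - 2 * f m n)
    (hg₀ : ∀ n, g 0 n = 1) (hg₁ : ∀ m, g m 0 = 1)
    (hg : ∀ m n, g (m + 1) (n + 1) = g m (n + 1) + g (m + 1) n - 2 * g m n) (m n : ℕ) :
    f m n = g m n := by
  induction m generalizing n with
  | zero => rw [hf₀, hg₀]
  | succ m ihm =>
    induction n with
    | zero => rw [hf₁, hg₁]
    | succ n ihn => rw [hf, hg, ihm, ihm, ihn]

theorem signedCount_comm (m n : ℕ) :
    signedCount (m + 1) (n + 1) = signedCount (n + 1) (m + 1) :=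
  eq_of_pascal (f := fun m n => signedCount (m + 1) (n + 1))
    (g := fun m n => signedCount (n + 1) (m + 1)) signedCount_one_left signedCount_one
    signedCount_pascal signedCount_one signedCount_one_left
    (fun m n => by have := signedCount_pascal n m; linarith) m n

theorem signedCount_eq_coeff (m n : ℕ) :
    signedCount (m + 1) (n + 1) = ((1 - X) ^ m * (1 + X) ^ n : ℤ[X]).coeff n := by
  refine eq_of_pascal (f := fun m n => signedCount (m + 1) (n + 1))
    (g := fun m n => ((1 - X) ^ m * (1 + X) ^ n : ℤ[X]).coeff n) signedCount_one_left
    signedCount_one signedCount_pascal ?_ ?_ ?_ m n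
  · intro n
    simp [coeff_one_add_X_pow]
  · intro m
    simp [coeff_zero_eq_eval_zero]
  · intro m n
    set P : ℤ[X] := (1 - X) ^ m * (1 + X) ^ n with hP
    have h1 : ((1 - X) ^ (m + 1) * (1 + X) ^ (n + 1) : ℤ[X]) = P - P * X * X := by
      rw [hP]; ring
    have h2 : ((1 - X) ^ m * (1 + X) ^ (n + 1) : ℤ[X]) = P + P * X := by
      rw [hP]; ring
    have h3 : ((1 - X) ^ (m + 1) * (1 + X) ^ n : ℤ[X]) = P - P * X := by
      rw [hP]; ring
    simp only [h1, h2, h3, coeff_add, coeff_sub, coeff_mul_X]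
    ring

theorem re_I_pow_eq_zero {k : ℕ} (hk : Odd k) : (Complex.I ^ k).re = 0 := by
  obtain ⟨l, rfl⟩ := hk
  rw [pow_succ, pow_mul, Complex.I_sq]
  rcases neg_one_pow_eq_or ℂ l with h | h <;> simp [h]

/-- `Re I^k` is `(-1)^(k/2)` for even `k` and zero for odd `k`, so one formula covers both parities.
-/
theorem coeff_one_sub_X_sq_pow (m k : ℕ) :
    (((1 - X ^ 2) ^ m : ℤ[X]).coeff k : ℝ) = (Complex.I ^ k).re * m.choose (k / 2) := by
  have h : ((1 - X ^ 2) ^ m : ℤ[X]) = expand ℤ 2 ((1 - X) ^ m) := by simp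
  rw [h, coeff_expand two_pos]
  obtain ⟨l, rfl | rfl⟩ := Nat.even_or_odd' k
  · rw [if_pos (dvd_mul_right _ _), Nat.mul_div_cancel_left _ two_pos, pow_mul, Complex.I_sq]
    have h' : ((1 - X) ^ m : ℤ[X]) = ((1 + X) ^ m : ℤ[X]).comp (C (-1) * X) := by
      simp [sub_eq_add_neg]
    rw [h', comp_C_mul_X_coeff, coeff_one_add_X_pow]
    have : ((-1 : ℂ) ^ l).re = (-1) ^ l := by
      rw [← Complex.ofReal_one, ← Complex.ofReal_neg, ← Complex.ofReal_pow, Complex.ofReal_re]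
    rw [this]
    push_cast
    ring
  · rw [if_neg (by omega), re_I_pow_eq_zero (odd_two_mul_add_one l), zero_mul, Int.cast_zero]

theorem signedCount_eq_sum (m d : ℕ) :
    (signedCount (m + 1) (m + d + 1) : ℝ) =
      ∑ j ∈ Finset.range (d + 1),
        d.choose j * ((Complex.I ^ (m + j)).re * m.choose ((m + j) / 2)) := by
  have h : ((1 - X) ^ m * (1 + X) ^ (m + d) : ℤ[X]) = (1 - X ^ 2) ^ m * (X + 1) ^ d := by
    rw [pow_add, ← mul_assoc, ← mul_pow]; congr 2 <;> ring
  rw [signedCount_eq_coeff, h, add_pow, Finset.mul_sum, finsetSum_coeff,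
    ← Finset.sum_range_reflect]
  push_cast
  refine Finset.sum_congr rfl fun j hj => ?_
  have hj' : j ≤ d := by simpa [Nat.lt_succ_iff] using hj
  rw [← coeff_one_sub_X_sq_pow]
  have e : ((1 - X ^ 2) ^ m * (X ^ (d - j) * 1 ^ (d - (d - j)) *
      (d.choose (d - j) : ℤ[X])) : ℤ[X]) =
      C (d.choose j : ℤ) * ((1 - X ^ 2) ^ m * X ^ (d - j)) := by
    rw [Nat.choose_symm hj', one_pow]
    simp
    ring
  rw [e, coeff_C_mul, show m + d = m + j + (d - j) by omega, coeff_mul_X_pow]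
  push_cast
  rfl

end

/-! ### Weighted binomial moments and first-order asymptotics of binomial ratios. -/

section

open Filter Topology

theorem sum_choose_mul_succ {R : Type*} [CommRing R] (d : ℕ) (g : ℕ → R) :
    ∑ j ∈ Finset.range (d + 2), ((d + 1).choose j : R) * g j =
      ∑ j ∈ Finset.range (d + 1), (d.choose j : R) * (g j + g (j + 1)) := by
  rw [Finset.sum_range_succ']
  simp only [Nat.choose_succ_succ, Nat.cast_add, add_mul, mul_add, Finset.sum_add_distrib]
  have h := Finset.sum_range_succ' (fun j => (d.choose j : R) * g j) (d + 1)
  rw [Finset.sum_range_succ] at h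
  simp at h ⊢
  linear_combination -h

theorem sum_choose_mul_pow {R : Type*} [CommRing R] (d : ℕ) (x : R) :
    ∑ j ∈ Finset.range (d + 1), (d.choose j : R) * x ^ j = (1 + x) ^ d := by
  rw [add_comm 1 x, add_pow]
  exact Finset.sum_congr rfl fun j _ => by ring

/-- Derivative of the binomial theorem, multiplied by `1 + x` to avoid the exponent `d - 1`. -/
theorem sum_choose_mul_pow_mul {R : Type*} [CommRing R] (d : ℕ) (x : R) :
    (1 + x) * ∑ j ∈ Finset.range (d + 1), (d.choose j : R) * (x ^ j * j) =
      d * x * (1 + x) ^ d := by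
  induction d with
  | zero => simp
  | succ d ih =>
    have h : ∀ j : ℕ, (d.choose j : R) * (x ^ j * j + x ^ (j + 1) * ((j + 1 : ℕ) : R)) =
      (1 + x) * (d.choose j * (x ^ j * j)) + x * (d.choose j * x ^ j) := by
      intro j; push_cast; ring
    rw [sum_choose_mul_succ]
    simp only [h]
    rw [Finset.sum_add_distrib, ← Finset.mul_sum, ← Finset.mul_sum, ih, sum_choose_mul_pow]
    push_cast
    ring

theorem sum_choose_mul_pow_mul_sq {R : Type*} [CommRing R] (d : ℕ) (x : R) :
    (1 + x) ^ 2 * ∑ j ∈ Finset.range (d + 1), (d.choose j : R) * (x ^ j * j ^ 2) =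
      d * x * (1 + d * x) * (1 + x) ^ d := by
  induction d with
  | zero => simp
  | succ d ih =>
    have h : ∀ j : ℕ, (d.choose j : R) * (x ^ j * j ^ 2 + x ^ (j + 1) * ((j + 1 : ℕ) : R) ^ 2) =
      (1 + x) * (d.choose j * (x ^ j * j ^ 2)) + 2 * x * (d.choose j * (x ^ j * j))
        + x * (d.choose j * x ^ j) := by
      intro j; push_cast; ring
    rw [sum_choose_mul_succ]
    simp only [h]
    rw [Finset.sum_add_distrib, Finset.sum_add_distrib, ← Finset.mul_sum, ← Finset.mul_sum,
      ← Finset.mul_sum, sum_choose_mul_pow]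
    have h1 := sum_choose_mul_pow_mul d x
    push_cast
    linear_combination (1 + x) * ih + 2 * x * (1 + x) * h1

/-- The binomial coefficient `(2p+e).choose (p+e+s)`, relative to `(2p+e).choose (p+e)`. -/
noncomputable def chooseRatio (e s p : ℕ) : ℝ :=
  (2 * p + e).choose (p + e + s) / (2 * p + e).choose (p + e)

theorem chooseRatio_zero (e p : ℕ) : chooseRatio e 0 p = 1 := by
  have : ((2 * p + e).choose (p + e) : ℝ) ≠ 0 := by
    exact_mod_cast (Nat.choose_pos (by omega)).ne'
  simp [chooseRatio, this]

theorem chooseRatio_succ (e : ℕ) {s p : ℕ} (hs : s ≤ p) :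
    chooseRatio e (s + 1) p = chooseRatio e s p * (((p : ℝ) - s) / (p + e + s + 1)) := by
  have h := Nat.choose_succ_right_eq (2 * p + e) (p + e + s)
  rw [show 2 * p + e - (p + e + s) = p - s by omega] at h
  have h' : ((2 * p + e).choose (p + e + s + 1) : ℝ) * (p + e + s + 1) =
      (2 * p + e).choose (p + e + s) * ((p : ℝ) - s) := by
    rw [← Nat.cast_sub hs]; exact_mod_cast h
  have hpos : (0 : ℝ) < p + e + s + 1 := by positivity
  unfold chooseRatio
  rw [← add_assoc, div_mul_div_comm, mul_comm (Nat.cast (Nat.choose _ (p + e))), ← div_div, ← h',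
    mul_div_cancel_right₀ _ hpos.ne']

theorem tendsto_natCast_mul_sub_div (e s : ℕ) :
    Tendsto (fun p : ℕ => (p : ℝ) * (((p : ℝ) - s) / (p + e + s + 1) - 1)) atTop
      (𝓝 (-(2 * s + e + 1 : ℝ))) := by
  have h : Tendsto (fun p : ℕ => -(2 * s + e + 1 : ℝ) * ((p : ℝ) / (p + (e + s + 1 : ℝ)))) atTop
      (𝓝 (-(2 * s + e + 1 : ℝ) * 1)) :=
    (tendsto_natCast_div_add_atTop (e + s + 1 : ℝ)).const_mul _
  rw [mul_one] at h
  refine h.congr fun p => ?_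
  have hpos : (0 : ℝ) < p + e + s + 1 := by positivity
  rw [show (p : ℝ) + (e + s + 1) = p + e + s + 1 by ring]
  field_simp
  ring

theorem tendsto_of_tendsto_natCast_mul_sub {u : ℕ → ℝ} {a l : ℝ}
    (h : Tendsto (fun p : ℕ => (p : ℝ) * (u p - a)) atTop (𝓝 l)) : Tendsto u atTop (𝓝 a) := by
  have h1 : Tendsto (fun p : ℕ => (p : ℝ)⁻¹ * ((p : ℝ) * (u p - a)) + a) atTop
      (𝓝 (0 * l + a)) :=
    (tendsto_inv_atTop_nhds_zero_nat.mul h).add_const a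
  rw [zero_mul, zero_add] at h1
  refine h1.congr' ?_
  filter_upwards [eventually_gt_atTop 0] with p hp
  have : (p : ℝ) ≠ 0 := by positivity
  field_simp
  ring

/-- The ratio is a product of factors `1 - (2i+e+1)/p + o(1/p)`, `i < s`, and these numerators sum
to `s² + es`. -/
theorem tendsto_natCast_mul_chooseRatio_sub_one (e s : ℕ) :
    Tendsto (fun p : ℕ => (p : ℝ) * (chooseRatio e s p - 1)) atTop
      (𝓝 (-(s ^ 2 + e * s : ℝ))) := by
  induction s with
  | zero => simp [chooseRatio_zero]
  | succ s ih =>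
    have h := (tendsto_natCast_mul_sub_div e s)
    have h1 := (ih.mul (tendsto_of_tendsto_natCast_mul_sub h)).add h
    have : -(s ^ 2 + e * s : ℝ) * 1 + -(2 * s + e + 1 : ℝ) =
      -(((s + 1 : ℕ) : ℝ) ^ 2 + e * ((s + 1 : ℕ) : ℝ)) := by push_cast; ring
    rw [this] at h1
    refine h1.congr' ?_
    filter_upwards [eventually_ge_atTop s] with p hp
    rw [chooseRatio_succ e hp]
    ring

end

/-! ### Asymptotics of the rescaled count and its eventual sign. -/

section

open Filter Topology

/-- `signedCount (2p+e+1) (2p+e+d+1)` relative to `(-1)^p * (2p+e).choose (p+e)`. -/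
noncomputable def scaledCount (d e p : ℕ) : ℝ :=
  ∑ j ∈ Finset.range (d + 1),
    d.choose j * ((Complex.I ^ (e + j)).re * chooseRatio e ((j - e) / 2) p)

theorem signedCount_eq_scaledCount (d p : ℕ) {e : ℕ} (he : e < 2) :
    (signedCount (2 * p + e + 1) (2 * p + e + d + 1) : ℝ) =
      (-1) ^ p * ((2 * p + e).choose (p + e) * scaledCount d e p) := by
  rw [signedCount_eq_sum, scaledCount, Finset.mul_sum, Finset.mul_sum]
  refine Finset.sum_congr rfl fun j _ => ?_
  have hre : (Complex.I ^ (2 * p + e + j)).re = (-1) ^ p * (Complex.I ^ (e + j)).re := by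
    rw [add_assoc, pow_add, pow_mul, Complex.I_sq]
    rcases Nat.even_or_odd p with hp | hp <;> simp [hp.neg_one_pow]
  rw [hre]
  -- Truncation in `(j - e) / 2` is harmless: if `j < e`, then `e + j = 1` and the term vanishes.
  rcases Nat.even_or_odd (e + j) with h | h
  · obtain ⟨r, hr⟩ := h
    have h0 : ((2 * p + e).choose (p + e) : ℝ) ≠ 0 := by
      exact_mod_cast (Nat.choose_pos (by omega)).ne'
    rw [chooseRatio, show (2 * p + e + j) / 2 = p + e + (j - e) / 2 by omega]
    field_simp
  · simp [re_I_pow_eq_zero h]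

/-- With `j = 2s+e`, the correction `-(s²+es)` is `-(j²-e²)/4`, so the limit follows from the zeroth
and second binomial moments at `x = I`. -/
theorem tendsto_scaledCount (d : ℕ) {e : ℕ} (he : e < 2) {z : ℂ}
    (hz : z = Complex.I ^ e * (1 + Complex.I) ^ d) :
    Tendsto (fun p : ℕ => (p : ℝ) * (scaledCount d e p - z.re)) atTop
      (𝓝 (((e : ℝ) ^ 2 / 4 - d / 8) * z.re + (d : ℝ) ^ 2 / 8 * z.im)) := by
  have h0 : z = ∑ j ∈ Finset.range (d + 1), (d.choose j : ℂ) * Complex.I ^ (e + j) := by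
    rw [hz, ← sum_choose_mul_pow, Finset.mul_sum]
    exact Finset.sum_congr rfl fun j _ => by ring
  have h2 : (d : ℂ) * (1 + d * Complex.I) / 2 * z =
      ∑ j ∈ Finset.range (d + 1), (d.choose j : ℂ) * (Complex.I ^ (e + j) * j ^ 2) := by
    have h := sum_choose_mul_pow_mul_sq d Complex.I
    have h1 : (1 + Complex.I) ^ 2 = 2 * Complex.I := by
      linear_combination Complex.I_sq
    have h3 : ∑ j ∈ Finset.range (d + 1), (d.choose j : ℂ) * (Complex.I ^ (e + j) * j ^ 2) =
        Complex.I ^ e *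
          ∑ j ∈ Finset.range (d + 1), (d.choose j : ℂ) * (Complex.I ^ j * j ^ 2) := by
      rw [Finset.mul_sum]
      exact Finset.sum_congr rfl fun j _ => by ring
    rw [h1] at h
    rw [h3, hz]
    apply mul_left_cancel₀ (mul_ne_zero two_ne_zero Complex.I_ne_zero)
    linear_combination -Complex.I ^ e * h
  have hre0 : z.re = ∑ j ∈ Finset.range (d + 1), (d.choose j : ℝ) * (Complex.I ^ (e + j)).re := by
    rw [h0, Complex.re_sum]
    exact Finset.sum_congr rfl fun j _ => by simp
  have hre2 : (d : ℝ) / 2 * (z.re - d * z.im) = ∑ j ∈ Finset.range (d + 1),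
      (d.choose j : ℝ) * ((Complex.I ^ (e + j)).re * j ^ 2) := by
    have := congrArg Complex.re h2
    rw [Complex.re_sum] at this
    have e1 : (d : ℂ) * (1 + d * Complex.I) / 2 * z =
        ((d / 2 : ℝ) : ℂ) * (z + (d : ℝ) * (Complex.I * z)) := by
      push_cast; ring
    rw [e1, Complex.re_ofReal_mul, Complex.add_re, Complex.re_ofReal_mul, Complex.I_mul_re] at this
    rw [sub_eq_add_neg, ← mul_neg, this]
    refine Finset.sum_congr rfl fun j _ => ?_
    rw [← Complex.ofReal_natCast, ← Complex.ofReal_natCast, Complex.re_ofReal_mul,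
      ← Complex.ofReal_pow, Complex.re_mul_ofReal]
  have hlim : ((e : ℝ) ^ 2 / 4 - d / 8) * z.re + (d : ℝ) ^ 2 / 8 * z.im =
      ∑ j ∈ Finset.range (d + 1),
        (d.choose j : ℝ) * ((Complex.I ^ (e + j)).re * (-((j : ℝ) ^ 2 - e ^ 2) / 4)) := by
    have : ∀ j : ℕ, (d.choose j : ℝ) * ((Complex.I ^ (e + j)).re * (-((j : ℝ) ^ 2 - e ^ 2) / 4)) =
        (e : ℝ) ^ 2 / 4 * ((d.choose j : ℝ) * (Complex.I ^ (e + j)).re) -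
          1 / 4 * ((d.choose j : ℝ) * ((Complex.I ^ (e + j)).re * j ^ 2)) := by
      intro j; ring
    simp only [this]
    rw [Finset.sum_sub_distrib, ← Finset.mul_sum, ← Finset.mul_sum, ← hre0, ← hre2]
    ring
  have hfun : (fun p : ℕ => (p : ℝ) * (scaledCount d e p - z.re)) = fun p : ℕ =>
      ∑ j ∈ Finset.range (d + 1), (d.choose j : ℝ) *
        ((Complex.I ^ (e + j)).re * ((p : ℝ) * (chooseRatio e ((j - e) / 2) p - 1))) := by
    funext p
    rw [hre0, scaledCount, ← Finset.sum_sub_distrib, Finset.mul_sum]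
    exact Finset.sum_congr rfl fun j _ => by ring
  rw [hlim, hfun]
  refine tendsto_finsetSum _ fun j _ => Tendsto.const_mul _ ?_
  rcases Nat.even_or_odd (e + j) with h | h
  · rcases Nat.lt_or_ge j e with hj | hj
    · obtain ⟨r, hr⟩ := h
      omega
    · obtain ⟨s, hs⟩ : ∃ s, j = 2 * s + e := ⟨(j - e) / 2, by obtain ⟨r, hr⟩ := h; omega⟩
      have h' := tendsto_natCast_mul_chooseRatio_sub_one e s
      rw [show (j - e) / 2 = s by omega]
      convert h'.const_mul _ using 2
      rw [hs]
      push_cast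
      ring
  · simp [re_I_pow_eq_zero h]

theorem eventually_scaledCount_pos {d e : ℕ} (hd : d ≠ 0) (he : e < 2) {z : ℂ}
    (hz : z = Complex.I ^ e * (1 + Complex.I) ^ d) (hpos : 0 < z.re ∨ z.re = 0 ∧ 0 < z.im) :
    ∀ᶠ p : ℕ in atTop, 0 < scaledCount d e p := by
  have h := tendsto_scaledCount d he hz
  rcases hpos with h1 | ⟨h1, h2⟩
  · exact (tendsto_of_tendsto_natCast_mul_sub h).eventually_const_lt h1
  · rw [h1, mul_zero, zero_add] at h
    filter_upwards [h.eventually_const_lt (u := 0) (by positivity)] with p hp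
    rw [sub_zero] at hp
    exact pos_of_mul_pos_right hp (Nat.cast_nonneg p)

theorem eventually_scaledCount_neg {d e : ℕ} (hd : d ≠ 0) (he : e < 2) {z : ℂ}
    (hz : z = Complex.I ^ e * (1 + Complex.I) ^ d) (hneg : z.re < 0 ∨ z.re = 0 ∧ z.im < 0) :
    ∀ᶠ p : ℕ in atTop, scaledCount d e p < 0 := by
  have h := tendsto_scaledCount d he hz
  rcases hneg with h1 | ⟨h1, h2⟩
  · exact (tendsto_of_tendsto_natCast_mul_sub h).eventually_lt_const h1
  · rw [h1, mul_zero, zero_add] at h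
    have : (d : ℝ) ^ 2 / 8 * z.im < 0 := mul_neg_of_pos_of_neg (by positivity) h2
    filter_upwards [h.eventually_lt_const this] with p hp
    rw [sub_zero] at hp
    exact neg_of_mul_neg_right hp (Nat.cast_nonneg p)

theorem I_pow_mul_one_add_I_pow (m q r : ℕ) :
    Complex.I ^ m * (1 + Complex.I) ^ (2 * q + r) =
      ((2 ^ q : ℝ) : ℂ) * (Complex.I ^ ((m + q) % 4) * (1 + Complex.I) ^ r) := by
  have h1 : (1 + Complex.I) ^ 2 = 2 * Complex.I := by
    linear_combination Complex.I_sq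
  rw [← Complex.I_pow_eq_pow_mod, pow_add (1 + Complex.I), pow_mul, h1, mul_pow, pow_add]
  push_cast
  ring

/-- The argument of `z` is `(2m+d)π/4`; residues 7, 0, 1, 2 are those in `(-π/2, π/2]`. Since
`(1+I)² = 2I`, only eight cases remain. -/
theorem I_pow_mul_one_add_I_pow_sign (m d : ℕ) {z : ℂ}
    (hz : z = Complex.I ^ m * (1 + Complex.I) ^ d) :
    ((2 * m + d) % 8 = 7 ∨ (2 * m + d) % 8 < 3) ∧ (0 < z.re ∨ z.re = 0 ∧ 0 < z.im) ∨
    ¬ ((2 * m + d) % 8 = 7 ∨ (2 * m + d) % 8 < 3) ∧ (z.re < 0 ∨ z.re = 0 ∧ z.im < 0) := by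
  obtain ⟨q, r, hr, rfl⟩ : ∃ q r, r < 2 ∧ d = 2 * q + r := ⟨d / 2, d % 2, by omega, by omega⟩
  rw [I_pow_mul_one_add_I_pow] at hz
  have h2 : (0 : ℝ) < 2 ^ q := by positivity
  rw [show (2 * m + (2 * q + r)) % 8 = 2 * ((m + q) % 4) + r by omega, hz, Complex.re_ofReal_mul,
    Complex.im_ofReal_mul]
  have hn : (m + q) % 4 < 4 := Nat.mod_lt _ (by norm_num)
  generalize (m + q) % 4 = n at hn
  have h3 : Complex.I ^ 3 = -Complex.I := Complex.I_pow_three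
  interval_cases n <;> interval_cases r <;> simp [h2, h3]

theorem eventually_signedCount_pos_iff {d : ℕ} (hd : d ≠ 0) :
    ∃ m₀ : ℕ, ∀ m : ℕ, m₀ ≤ m → (0 < signedCount (m + 1) (m + d + 1) ↔
      (2 * m + d) % 8 = 7 ∨ (2 * m + d) % 8 < 3) := by
  have key : ∀ e : ℕ, e < 2 → ∀ᶠ p : ℕ in atTop,
      (0 < signedCount (2 * p + e + 1) (2 * p + e + d + 1) ↔
        (2 * (2 * p + e) + d) % 8 = 7 ∨ (2 * (2 * p + e) + d) % 8 < 3) := by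
    intro e he
    have hs := I_pow_mul_one_add_I_pow_sign e d rfl
    have hcast : ∀ p, 0 < signedCount (2 * p + e + 1) (2 * p + e + d + 1) ↔
        0 < (-1 : ℝ) ^ p * ((2 * p + e).choose (p + e) * scaledCount d e p) := by
      intro p
      rw [← signedCount_eq_scaledCount d p he, Int.cast_pos]
    have hc : ∀ p, (0 : ℝ) < (2 * p + e).choose (p + e) := fun p => by
      exact_mod_cast Nat.choose_pos (by omega)
    rcases hs with ⟨h1, h2⟩ | ⟨h1, h2⟩
    · filter_upwards [eventually_scaledCount_pos hd he rfl h2] with p hp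
      rw [hcast]
      have := mul_pos (hc p) hp
      -- For odd `p`, `(-1)^p` flips the sign while `4p` shifts the residue by 4, swapping the two
      -- residue classes.
      rcases Nat.even_or_odd p with h | h
      · rw [h.neg_one_pow, one_mul]
        obtain ⟨r, rfl⟩ := h
        exact iff_of_true this (by omega)
      · rw [h.neg_one_pow, neg_one_mul]
        obtain ⟨r, rfl⟩ := h
        exact iff_of_false (by linarith) (by omega)
    · filter_upwards [eventually_scaledCount_neg hd he rfl h2] with p hp
      rw [hcast]
      have := mul_neg_of_pos_of_neg (hc p) hp
      rcases Nat.even_or_odd p with h | h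
      · rw [h.neg_one_pow, one_mul]
        obtain ⟨r, rfl⟩ := h
        exact iff_of_false (by linarith) (by omega)
      · rw [h.neg_one_pow, neg_one_mul]
        obtain ⟨r, rfl⟩ := h
        exact iff_of_true (by linarith) (by omega)
  obtain ⟨a, ha⟩ := eventually_atTop.1 (key 0 (by norm_num))
  obtain ⟨b, hb⟩ := eventually_atTop.1 (key 1 (by norm_num))
  refine ⟨2 * (a + b) + 2, fun m hm => ?_⟩
  obtain ⟨p, rfl | rfl⟩ := Nat.even_or_odd' m
  · exact ha p (by omega)
  · exact hb p (by omega)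

end

theorem theorem2 (d : ℤ) (hd : d ≠ 0) :
    ∃ w₀ : ℕ, ∀ w h : ℕ, w₀ < w → (h : ℤ) = (w : ℤ) + d →
      ((evenStepDiagrams w h).ncard < (oddStepDiagrams w h).ncard ↔
        (2 * (w : ℤ) + d) % 8 = 1 ∨ (2 * (w : ℤ) + d) % 8 = 2 ∨
          (2 * (w : ℤ) + d) % 8 = 3 ∨ (2 * (w : ℤ) + d) % 8 = 4) := by
  obtain ⟨m₀, hm₀⟩ := eventually_signedCount_pos_iff (d := d.natAbs) (by omega)
  refine ⟨m₀ + d.natAbs + 1, fun w h hw hh => ?_⟩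
  have hcount : (evenStepDiagrams w h).ncard < (oddStepDiagrams w h).ncard ↔
      0 < signedCount w h := by
    rw [signedCount_eq]; omega
  rw [hcount]
  -- By symmetry the shorter side may be taken as `m + 1`. Then `2w + d = w + h = 2m + |d| + 2`,
  -- which turns residues 7, 0, 1, 2 into 1, 2, 3, 4.
  rcases lt_or_gt_of_ne hd with hneg | hpos
  · obtain ⟨m, rfl⟩ : ∃ m, h = m + 1 := ⟨h - 1, by omega⟩
    obtain rfl : w = m + d.natAbs + 1 := by omega
    rw [signedCount_comm, hm₀ m (by omega)]
    omega
  · obtain ⟨m, rfl⟩ : ∃ m, w = m + 1 := ⟨w - 1, by omega⟩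
    obtain rfl : h = m + d.natAbs + 1 := by omega
    rw [hm₀ m (by omega)]
    omega
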